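/- Let $d\ge 2$ be an integer and $f\in[0,1]$. Let $|\Phi^+_d\rangle=\frac1{\sqrt d}\sum_{i=1}^d|ii\rangle$, $\Phi^+_d=|\Phi^+_d\rangle\langle\Phi^+_d|$, and let $$\rho_{d,f}=f\,\Phi^+_d+\frac{1-f}{d^2-1}\left(\mathbb 1_{AB}-\Phi^+_d\right)$$ be the isotropic state on $A\otimes B=\mathbb C^d\otimes\mathbb C^d$, shared by Alice and Bob on a single port $B$. For a linear map $\Lambda$ on the operators on $\mathbb C^d$ let $\mathsf F(\Lambda)=\langle\Phi^+_d|(\mathrm{id}\otimes\Lambda)(\Phi^+_d)|\Phi^+_d\rangle$ be its entanglement fidelity. Let $\mathsf{PBT}_{\mathrm q}(\rho_{AB})$ be the set of all channels from $B'\cong\mathbb C^d$ to $B$ of the form $$\Lambda(\tau)=\mathrm{Tr}_{AB'}\big[\Pi^{(1)}_{AB'}(\rho_{AB}\otimes\tau_{B'})\big]+\sum_{i=2}^{s}\mathrm{Tr}\big[\Pi^{(i)}_{AB'}(\rho_A\otimes\tau_{B'})\big]\,\sigma^{(i)}_B ,$$ where $s\ge1$, $\{\Pi^{(i)}_{AB'}\}_{i=1}^s$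 is a POVM on $A\otimes B'$, $\rho_A=\mathrm{Tr}_B\,\rho_{AB}$, and the $\sigma^{(i)}_B$ are arbitrary density matrices on $B$; let $\mathsf{PBT}_{\mathrm{cl}}(\rho_{AB})$ be the subset obtained when every $\sigma^{(i)}_B$ is required to be diagonal in the computational basis. Put $\mathsf F_{\Omega}(\rho_{AB})=\max\{\mathsf F(\Lambda):\Lambda\in\Omega(\rho_{AB})\}$ for $\Omega\in\{\mathsf{PBT}_{\mathrm q},\mathsf{PBT}_{\mathrm{cl}}\}$. Then both maxima are attained for $\rho_{AB}=\rho_{d,f}$, and $$\mathsf F_{\mathsf{PBT}_{\mathrm q}}(\rho_{d,f})=\begin{cases}\dfrac1d+\dfrac f{d^2}-\dfrac1{d^3}&\text{if } f\ge 1/d,\\[2mm] \dfrac1d&\text{otherwise.}\end{cases}$$ Moreover, $\mathsf F_{\mathsf{PBT}_{\mathrm{cl}}}(\rho_{d,f})<\mathsf F_{\mathsf{PBT}_{\mathrm q}}(\rho_{d,f})$ for all $f>1/d$. -/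

import Mathlib

open scoped Kronecker Matrix ComplexOrder

noncomputable section

namespace AsyncPBT

/-- Density matrices (quantum states) on the system with basis `X`. -/
def IsState {X : Type*} [Fintype X] (ρ : Matrix X X ℂ) : Prop :=
  ρ.PosSemidef ∧ ρ.trace = 1

/-- Classical states: density matrices that are diagonal in the computational basis. -/
def IsClassicalState {X : Type*} [Fintype X] (ρ : Matrix X X ℂ) : Prop :=
  IsState ρ ∧ ρ.IsDiag

/-- Positive operator-valued measures on the system `X` with outcome set `ι`. -/
def IsPOVM {X ι : Type*} [Fintype X] [DecidableEq X] [Fintype ι]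
    (E : ι → Matrix X X ℂ) : Prop :=
  (∀ i, (E i).PosSemidef) ∧ ∑ i, E i = 1

/-- The partial trace `Tr_X` over the first tensor factor. -/
def traceFst {X Y : Type*} [Fintype X] (M : Matrix (X × Y) (X × Y) ℂ) : Matrix Y Y ℂ :=
  Matrix.of fun y y' => ∑ x, M (x, y) (x, y')

/-- The partial trace `Tr_Y` over the second tensor factor. -/
def traceSnd {X Y : Type*} [Fintype Y] (M : Matrix (X × Y) (X × Y) ℂ) : Matrix X X ℂ :=
  Matrix.of fun x x' => ∑ y, M (x, y) (x', y)

/-- For an operator `ρ` on `A ⊗ B₁ ⊗ ⋯ ⊗ Bₙ`, the reduced operator on `A ⊗ Bᵢ` after discarding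
all ports other than the `i`-th one, which is relabelled `B`. -/
def portMarginal {A B : Type*} [Fintype B] {n : ℕ} (i : Fin n)
    (ρ : Matrix (A × (Fin n → B)) (A × (Fin n → B)) ℂ) : Matrix (A × B) (A × B) ℂ :=
  Matrix.of fun x y => ∑ c : {j : Fin n // j ≠ i} → B,
    ρ (x.1, (Equiv.funSplitAt i B).symm (x.2, c)) (y.1, (Equiv.funSplitAt i B).symm (y.2, c))

/-- `Tr_{AC} [(E_{AC} ⊗ 1_B) (ρ_{AB} ⊗ τ_C)]`, an operator on `B`: the (unnormalised) state of
Bob's system `B` when Alice's measurement of `AC` yields the outcome with POVM element `E`. -/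
def postMeasurement {A B C : Type*} [Fintype A] [Fintype B] [DecidableEq B] [Fintype C]
    (E : Matrix (A × C) (A × C) ℂ) (ρ : Matrix (A × B) (A × B) ℂ) (τ : Matrix C C ℂ) :
    Matrix B B ℂ :=
  traceFst ((E ⊗ₖ (1 : Matrix B B ℂ)) *
    (ρ ⊗ₖ τ).submatrix (fun x : (A × C) × B => ((x.1.1, x.2), x.1.2))
      (fun x : (A × C) × B => ((x.1.1, x.2), x.1.2)))

/-- The channels `Λ : C → B` generated from `ρ` on `A ⊗ Bⁿ` by port-based teleportation in which
Bob may moreover prepare the states satisfying `S`: Alice measures a POVM on `AC` with finitely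
many outcomes, the outcomes `Sum.inl i` telling Bob to keep only port `i`, and the outcomes
`Sum.inr j` telling him to discard all ports and output his ancilla prepared in `σ j`. -/
def pbtChannels {A B : Type*} [Fintype A] [DecidableEq A] [Fintype B] [DecidableEq B] {n : ℕ}
    (S : Matrix B B ℂ → Prop) (C : Type*) [Fintype C] [DecidableEq C]
    (ρ : Matrix (A × (Fin n → B)) (A × (Fin n → B)) ℂ) :
    Set (Matrix C C ℂ →ₗ[ℂ] Matrix B B ℂ) :=
  {Λ | ∃ (m : ℕ) (E : Fin n ⊕ Fin m → Matrix (A × C) (A × C) ℂ) (σ : Fin m → Matrix B B ℂ),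
    IsPOVM E ∧ (∀ j, S (σ j)) ∧
    ∀ τ : Matrix C C ℂ, Λ τ =
      ∑ i : Fin n, postMeasurement (E (Sum.inl i)) (portMarginal i ρ) τ +
      ∑ j : Fin m, (E (Sum.inr j) * (traceSnd ρ ⊗ₖ τ)).trace • σ j}

/-- `PBT_cl(ρ)`: port-based teleportation channels `B → B` where Bob may prepare classical
states. -/
def PBTcl {A B : Type*} [Fintype A] [DecidableEq A] [Fintype B] [DecidableEq B] {n : ℕ}
    (ρ : Matrix (A × (Fin n → B)) (A × (Fin n → B)) ℂ) :
    Set (Matrix B B ℂ →ₗ[ℂ] Matrix B B ℂ) :=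
  pbtChannels IsClassicalState B ρ

/-- `PBT_q(ρ)`: port-based teleportation channels `B → B` where Bob may prepare arbitrary
quantum states. -/
def PBTq {A B : Type*} [Fintype A] [DecidableEq A] [Fintype B] [DecidableEq B] {n : ℕ}
    (ρ : Matrix (A × (Fin n → B)) (A × (Fin n → B)) ℂ) :
    Set (Matrix B B ℂ →ₗ[ℂ] Matrix B B ℂ) :=
  pbtChannels IsState B ρ

/-- The canonical maximally entangled unit vector `|B|^{-1/2} ∑ᵢ |ii⟩`. -/
def maxEntVec (B : Type*) [Fintype B] [DecidableEq B] : B × B → ℂ :=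
  fun x => if x.1 = x.2 then (((Real.sqrt (Fintype.card B))⁻¹ : ℝ) : ℂ) else 0

/-- The projector `Φ⁺` onto the canonical maximally entangled vector. -/
def maxEntState (B : Type*) [Fintype B] [DecidableEq B] : Matrix (B × B) (B × B) ℂ :=
  Matrix.vecMulVec (maxEntVec B) (star (maxEntVec B))

/-- The map `id_R ⊗ Λ`. -/
def idTensor {B C : Type*} (R : Type*) (Λ : Matrix C C ℂ →ₗ[ℂ] Matrix B B ℂ)
    (X : Matrix (R × C) (R × C) ℂ) : Matrix (R × B) (R × B) ℂ :=
  Matrix.of fun x y => Λ (Matrix.of fun c c' => X (x.1, c) (y.1, c')) x.2 y.2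

/-- The entanglement fidelity `⟨Φ⁺| (id ⊗ Λ)(Φ⁺) |Φ⁺⟩`. -/
def entFidelity {B : Type*} [Fintype B] [DecidableEq B]
    (Λ : Matrix B B ℂ →ₗ[ℂ] Matrix B B ℂ) : ℝ :=
  (star (maxEntVec B) ⬝ᵥ (idTensor B Λ (maxEntState B) *ᵥ maxEntVec B)).re

/-- The optimal fidelity under `PBT_cl`. -/
def Fcl {A B : Type*} [Fintype A] [DecidableEq A] [Fintype B] [DecidableEq B] {n : ℕ}
    (ρ : Matrix (A × (Fin n → B)) (A × (Fin n → B)) ℂ) : ℝ :=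
  sSup (entFidelity '' PBTcl ρ)

/-- The optimal fidelity under `PBT_q`. -/
def Fq {A B : Type*} [Fintype A] [DecidableEq A] [Fintype B] [DecidableEq B] {n : ℕ}
    (ρ : Matrix (A × (Fin n → B)) (A × (Fin n → B)) ℂ) : ℝ :=
  sSup (entFidelity '' PBTq ρ)

/-- The isotropic state `f Φ⁺ + (1 - f)/(d² - 1) (1 - Φ⁺)` on `ℂ^d ⊗ ℂ^d`. -/
def isotropic (d : ℕ) (f : ℝ) : Matrix (Fin d × Fin d) (Fin d × Fin d) ℂ :=
  (f : ℂ) • maxEntState (Fin d) +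
    (((1 - f) / ((d : ℝ) ^ 2 - 1) : ℝ) : ℂ) • (1 - maxEntState (Fin d))

/-- A bipartite operator on `A ⊗ B`, regarded as shared on a single port. -/
def singlePort {A B : Type*} (ρ : Matrix (A × B) (A × B) ℂ) :
    Matrix (A × (Fin 1 → B)) (A × (Fin 1 → B)) ℂ :=
  ρ.submatrix (fun x => (x.1, x.2 0)) (fun x => (x.1, x.2 0))

end AsyncPBT

end

/-! Up to the factor `d⁻²`, the fidelity is linear in the POVM: it is `Tr (E₀ ρ) + ∑ⱼ Tr (Eⱼ (ρ_A ⊗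
σⱼ))`. For the isotropic state `ρ_A = 1/d`. With `p = Tr (E₀ Φ⁺) ∈ [0, 1]`, `score_isotropic`
rewrites this as `d + (f - 1/d) p` minus two nonnegative deficits: one for the weight of `E₀`
outside `Φ⁺`, one for the weight of each `Eⱼ` outside `1 ⊗ σⱼ`. Hence the bound `d + max (f - 1/d)
0`.

Attaining it requires `1 - E₀` to split into positive operators fixed by some `1 ⊗ σⱼ`. This is
immediate for `E₀ = 0`. For `E₀ = Φ⁺` it follows from an explicit separable decomposition of `1 -
Φ⁺` (`one_sub_maxEntState_eq`).

Classical preparations reduce to `d + 1` outcomes, so a maximum exists by compactness. If it reached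
the quantum value for `f > 1/d`, the deficits would vanish and force `E₀` to have no coherence
between `|yy⟩` and `|zz⟩`. Then `p ≤ 1/d`, although equality needs `p = 1`. -/

namespace AsyncPBT

open Matrix

/-! ### Trace inequalities for positive matrices and compactness of the set of POVMs -/

section PosSemidef

variable {X Y : Type*}

lemma posSemidef_diag_re_nonneg {M : Matrix X X ℂ} (hM : M.PosSemidef) (i : X) :
    0 ≤ (M i i).re := (Complex.le_def.1 (hM.diag_nonneg (i := i))).1

/-- The Cauchy-Schwarz inequality for the entries of a positive semidefinite matrix. -/
lemma posSemidef_norm_apply_sq_le {M : Matrix X X ℂ} (hM : M.PosSemidef) (i j : X) :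
    ‖M i j‖ ^ 2 ≤ (M i i).re * (M j j).re := by
  -- The inequality is nonnegativity of a 2 × 2 determinant; `i = j` is allowed.
  have h := (hM.submatrix ![i, j]).det_nonneg
  have hi := (Complex.le_def.1 (hM.diag_nonneg (i := i))).2
  have hj := (Complex.le_def.1 (hM.diag_nonneg (i := j))).2
  have hij : M j i = star (M i j) := (hM.isHermitian.apply j i).symm
  rw [det_fin_two] at h
  have h := (Complex.le_def.1 h).1
  simp only [submatrix_apply, cons_val_zero, cons_val_one, hij, Complex.sub_re, Complex.mul_re,
    Complex.star_def, Complex.conj_re, Complex.conj_im, Complex.zero_re, Complex.zero_im] at h hi hj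
  rw [← Complex.normSq_eq_norm_sq, Complex.normSq_apply]
  rw [← hi] at h
  linarith

lemma posSemidef_apply_eq_zero_left {M : Matrix X X ℂ} (hM : M.PosSemidef) {i : X}
    (hi : (M i i).re = 0) (j : X) : M i j = 0 := by
  have h := posSemidef_norm_apply_sq_le hM i j
  rw [hi, zero_mul] at h
  exact norm_eq_zero.1 (pow_eq_zero_iff two_ne_zero |>.1 (le_antisymm h (sq_nonneg _)))

lemma posSemidef_apply_eq_zero_right {M : Matrix X X ℂ} (hM : M.PosSemidef) {j : X}
    (hj : (M j j).re = 0) (i : X) : M i j = 0 := by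
  rw [← hM.isHermitian.apply, posSemidef_apply_eq_zero_left hM hj, star_zero]

variable [Fintype X]

/-- The trace is submultiplicative on positive semidefinite matrices. -/
lemma trace_mul_re_le {M N : Matrix X X ℂ} (hM : M.PosSemidef) (hN : N.PosSemidef) :
    (M * N).trace.re ≤ M.trace.re * N.trace.re := by
  -- Cauchy-Schwarz for both matrices, then AM-GM. The symmetrised bound sums exactly to the product
  -- of the traces.
  have key : ∀ i j, (M i j * N j i).re ≤
      ((M i i).re * (N j j).re + (M j j).re * (N i i).re) / 2 := by
    intro i j
    have h1 := posSemidef_norm_apply_sq_le hM i j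
    have h2 := posSemidef_norm_apply_sq_le hN j i
    have := posSemidef_diag_re_nonneg hM i
    have := posSemidef_diag_re_nonneg hM j
    have := posSemidef_diag_re_nonneg hN i
    have := posSemidef_diag_re_nonneg hN j
    refine (Complex.re_le_norm _).trans ?_
    rw [norm_mul]
    refine abs_le_of_sq_le_sq' ?_ (by positivity) |>.2
    have h3 := mul_le_mul h1 h2 (by positivity) (by positivity)
    nlinarith [sq_nonneg ((M i i).re * (N j j).re - (M j j).re * (N i i).re)]
  simp only [trace, diag_apply, mul_apply, Complex.re_sum]
  refine (Finset.sum_le_sum fun i _ => Finset.sum_le_sum fun j _ => key i j).trans (le_of_eq ?_)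
  rw [Finset.sum_mul_sum]
  simp only [← Finset.sum_div, Finset.sum_add_distrib]
  rw [Finset.sum_comm (f := fun i j => (M j j).re * (N i i).re)]
  ring

lemma trace_mul_vecMulVec_star (M : Matrix X X ℂ) (v : X → ℂ) :
    (M * vecMulVec v (star v)).trace = star v ⬝ᵥ M *ᵥ v := by
  rw [mul_vecMulVec, trace_vecMulVec, dotProduct_comm]

lemma traceFst_posSemidef {M : Matrix (X × Y) (X × Y) ℂ} (hM : M.PosSemidef) :
    (traceFst M).PosSemidef := by
  have : traceFst M = ∑ x, M.submatrix (fun y => (x, y)) (fun y => (x, y)) := by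
    ext y y'
    simp [traceFst, Matrix.sum_apply]
  rw [this]
  exact posSemidef_sum _ fun x _ => hM.submatrix _

variable [Fintype Y]

lemma trace_traceFst (M : Matrix (X × Y) (X × Y) ℂ) : (traceFst M).trace = M.trace := by
  simp only [trace, diag_apply, traceFst, of_apply, Fintype.sum_prod_type]
  exact Finset.sum_comm

lemma trace_mul_one_kronecker [DecidableEq X] (M : Matrix (X × Y) (X × Y) ℂ) (σ : Matrix Y Y ℂ) :
    (M * ((1 : Matrix X X ℂ) ⊗ₖ σ)).trace = (traceFst M * σ).trace := by
  simp only [trace, diag_apply, mul_apply, traceFst, of_apply, Fintype.sum_prod_type,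
    kroneckerMap_apply, one_apply, ite_mul, one_mul, zero_mul, mul_ite, mul_zero, Finset.sum_mul]
  simp only [Finset.sum_ite_irrel, Finset.sum_const_zero, Finset.sum_ite_eq', Finset.mem_univ,
    if_true]
  rw [Finset.sum_comm]
  exact Finset.sum_congr rfl fun y _ => Finset.sum_comm

/-- Tracing out the first factor reduces this to submultiplicativity of the trace, with `Tr σ = 1`.
It makes the preparation deficit nonnegative. -/
lemma trace_mul_one_kronecker_re_le [DecidableEq X] {M : Matrix (X × Y) (X × Y) ℂ}
    (hM : M.PosSemidef) {σ : Matrix Y Y ℂ} (hσ : IsState σ) :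
    (M * ((1 : Matrix X X ℂ) ⊗ₖ σ)).trace.re ≤ M.trace.re := by
  have h := trace_mul_re_le (traceFst_posSemidef hM) hσ.1
  rwa [hσ.2, trace_traceFst, Complex.one_re, mul_one, ← trace_mul_one_kronecker] at h

lemma isClosed_setOf_posSemidef : IsClosed {M : Matrix X X ℂ | M.PosSemidef} := by
  simp only [posSemidef_iff_dotProduct_mulVec, Set.ofPred_and, Set.ofPred_forall]
  refine IsClosed.inter ?_ (isClosed_iInter fun x => ?_)
  · exact isClosed_eq (f := fun M : Matrix X X ℂ => Mᴴ) (g := fun M => M) (by fun_prop) (by fun_prop)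
  · exact isClosed_le (by fun_prop) (by fun_prop)

variable {ι : Type*} [Fintype ι] [DecidableEq X]

lemma IsPOVM.diag_re_le_one {E : ι → Matrix X X ℂ} (hE : IsPOVM E) (i : ι) (x : X) :
    (E i x x).re ≤ 1 := by
  have h := congrArg (fun M : Matrix X X ℂ => (M x x).re) hE.2
  simp only [Matrix.sum_apply, Complex.re_sum, one_apply_eq, Complex.one_re] at h
  rw [← h]
  exact Finset.single_le_sum (f := fun i => (E i x x).re)
    (fun j _ => posSemidef_diag_re_nonneg (hE.1 j) x) (Finset.mem_univ i)

lemma isCompact_setOf_isPOVM : IsCompact {E : ι → Matrix X X ℂ | IsPOVM E} := by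
  have hK : IsCompact (Set.univ.pi fun _ : ι => Set.univ.pi fun _ : X => Set.univ.pi fun _ : X =>
      Metric.closedBall (0 : ℂ) 1) :=
    isCompact_univ_pi fun _ => isCompact_univ_pi fun _ => isCompact_univ_pi fun _ =>
      isCompact_closedBall _ _
  refine hK.of_isClosed_subset ?_ ?_
  · simp only [IsPOVM, Set.ofPred_and, Set.ofPred_forall]
    refine IsClosed.inter (isClosed_iInter fun i => ?_) ?_
    · exact (isClosed_setOf_posSemidef (X := X)).preimage
        (continuous_apply (A := fun _ : ι => Matrix X X ℂ) i)
    · exact isClosed_eq (by fun_prop) (by fun_prop)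
  · intro E hE i _ x _ y _
    rw [mem_closedBall_zero_iff]
    have h := posSemidef_norm_apply_sq_le (hE.1 i) x y
    have := hE.diag_re_le_one i x
    have := hE.diag_re_le_one i y
    have := posSemidef_diag_re_nonneg (hE.1 i) x
    have := posSemidef_diag_re_nonneg (hE.1 i) y
    refine abs_le_of_sq_le_sq' ?_ zero_le_one |>.2
    nlinarith

end PosSemidef

/-! ### The fidelity as a linear functional of the POVM -/

section Fidelity

lemma inv_sqrt_card_mul_self (B : Type*) [Fintype B] :
    ((((Real.sqrt (Fintype.card B))⁻¹ : ℝ) : ℂ) * (((Real.sqrt (Fintype.card B))⁻¹ : ℝ) : ℂ)) =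
      (Fintype.card B : ℂ)⁻¹ := by
  rw [← Complex.ofReal_mul, ← mul_inv, Real.mul_self_sqrt (Nat.cast_nonneg _)]
  simp

variable {A B C : Type*} [Fintype B]

lemma portMarginal_singlePort (i : Fin 1) (ρ : Matrix (A × B) (A × B) ℂ) :
    portMarginal i (singlePort ρ) = ρ := by
  obtain rfl : i = 0 := Subsingleton.elim _ _
  have : IsEmpty {j : Fin 1 // j ≠ 0} := ⟨fun j => j.2 (Subsingleton.elim _ _)⟩
  ext x y
  simp [portMarginal, singlePort, Equiv.funSplitAt, Equiv.piSplitAt]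

lemma traceSnd_singlePort (ρ : Matrix (A × B) (A × B) ℂ) :
    traceSnd (singlePort ρ) = traceSnd ρ := by
  ext x y
  exact Fintype.sum_equiv (Equiv.funUnique (Fin 1) B) _ _ fun c => rfl

variable [DecidableEq B]

lemma star_maxEntVec : star (maxEntVec B) = maxEntVec B := by
  ext x
  simp only [Pi.star_apply, maxEntVec]
  split_ifs
  · exact Complex.conj_ofReal _
  · exact star_zero _

lemma maxEntState_apply (x y : B × B) :
    maxEntState B x y = if x.1 = x.2 ∧ y.1 = y.2 then (Fintype.card B : ℂ)⁻¹ else 0 := by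
  rw [maxEntState, star_maxEntVec, vecMulVec_apply, ← inv_sqrt_card_mul_self]
  simp only [maxEntVec, ite_and]
  split_ifs <;> simp

lemma maxEntState_posSemidef : (maxEntState B).PosSemidef := posSemidef_vecMulVec_self_star _

lemma trace_maxEntState [Nonempty B] : (maxEntState B).trace = 1 := by
  simp [trace, maxEntState_apply, Fintype.sum_prod_type]

lemma trace_mul_maxEntState (M : Matrix (B × B) (B × B) ℂ) :
    (M * maxEntState B).trace = (Fintype.card B : ℂ)⁻¹ * ∑ x, ∑ y, M (x, x) (y, y) := by
  simp only [trace, diag_apply, mul_apply, maxEntState_apply, Fintype.sum_prod_type, ite_and,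
    mul_ite, mul_zero, Finset.sum_ite_irrel, Finset.sum_const_zero, Finset.sum_ite_eq,
    Finset.mem_univ, if_true, Finset.mul_sum, mul_comm]

lemma dotProduct_mulVec_maxEntVec (M : Matrix (B × B) (B × B) ℂ) :
    star (maxEntVec B) ⬝ᵥ M *ᵥ maxEntVec B =
      (Fintype.card B : ℂ)⁻¹ * ∑ x, ∑ y, M (x, x) (y, y) := by
  rw [← trace_mul_vecMulVec_star, ← trace_mul_maxEntState, maxEntState]

lemma entFidelity_eq (Λ : Matrix B B ℂ →ₗ[ℂ] Matrix B B ℂ) :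
    entFidelity Λ =
      ((Fintype.card B : ℂ)⁻¹ ^ 2 * ∑ x, ∑ y, Λ (Matrix.single x y 1) x y).re := by
  have h : ∀ x y : B, idTensor B Λ (maxEntState B) (x, x) (y, y) =
      (Fintype.card B : ℂ)⁻¹ * Λ (Matrix.single x y 1) x y := by
    intro x y
    have : (of fun c c' => maxEntState B (x, c) (y, c')) =
        (Fintype.card B : ℂ)⁻¹ • Matrix.single x y 1 := by
      ext c c'
      simp [maxEntState_apply, Matrix.single_apply]
    simp only [idTensor, of_apply]
    rw [this, map_smul, Matrix.smul_apply, smul_eq_mul]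
  rw [entFidelity, dotProduct_mulVec_maxEntVec]
  simp only [h, ← Finset.mul_sum]
  rw [← mul_assoc, sq]

variable [Fintype A] [Fintype C]

lemma postMeasurement_apply (E : Matrix (A × C) (A × C) ℂ) (ρ : Matrix (A × B) (A × B) ℂ)
    (τ : Matrix C C ℂ) (b b' : B) :
    postMeasurement E ρ τ b b' =
      ∑ x : A × C, ∑ y : A × C, E x y * (ρ (y.1, b) (x.1, b') * τ y.2 x.2) := by
  simp only [postMeasurement, traceFst, of_apply, mul_apply]
  refine Finset.sum_congr rfl fun x _ => ?_
  rw [Fintype.sum_prod_type]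
  refine Finset.sum_congr rfl fun y _ => ?_
  simp [one_apply]

/-- The quantity `Tr (E₀ ρ) + ∑ⱼ Tr (Eⱼ (ρ_A ⊗ σⱼ))`, proportional to the entanglement fidelity of
single-port teleportation. -/
noncomputable def score {ι : Type*} [Fintype ι] (ρ : Matrix (A × B) (A × B) ℂ)
    (E₀ : Matrix (A × B) (A × B) ℂ) (E : ι → Matrix (A × B) (A × B) ℂ)
    (σ : ι → Matrix B B ℂ) : ℂ :=
  (E₀ * ρ).trace + ∑ j, (E j * (traceSnd ρ ⊗ₖ σ j)).trace

/-- Summing over matrix units identifies Alice's input system with Bob's output, so her POVM element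
is paired directly with `ρ`. -/
lemma sum_postMeasurement_single (E ρ : Matrix (A × B) (A × B) ℂ) :
    ∑ x, ∑ y, postMeasurement E ρ (Matrix.single x y 1) x y = (E * ρ).trace := by
  simp only [postMeasurement_apply, trace, diag_apply, mul_apply, Matrix.single_apply, ite_and,
    mul_ite, mul_one, mul_zero]
  rw [Finset.sum_congr rfl fun x _ => Finset.sum_comm, Finset.sum_comm]
  refine Finset.sum_congr rfl fun z _ => ?_
  rw [Finset.sum_congr rfl fun x _ => Finset.sum_comm, Finset.sum_comm]
  refine Finset.sum_congr rfl fun w _ => ?_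
  simp [Finset.sum_ite_irrel]

lemma sum_trace_single_mul (E : Matrix (A × B) (A × B) ℂ) (R : Matrix A A ℂ) (σ : Matrix B B ℂ) :
    ∑ x, ∑ y, (E * (R ⊗ₖ Matrix.single x y 1)).trace * σ x y = (E * (R ⊗ₖ σ)).trace := by
  have h : R ⊗ₖ σ = ∑ x, ∑ y, σ x y • (R ⊗ₖ Matrix.single x y (1 : ℂ)) := by
    ext a b
    simp [Matrix.sum_apply, Matrix.single_apply, ite_and, mul_comm]
  rw [h]
  simp only [Finset.mul_sum, mul_smul_comm, trace_sum, trace_smul, smul_eq_mul, mul_comm]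

lemma entFidelity_eq_score {ι : Type*} [Fintype ι] {Λ : Matrix B B ℂ →ₗ[ℂ] Matrix B B ℂ}
    {ρ E₀ : Matrix (A × B) (A × B) ℂ} {E : ι → Matrix (A × B) (A × B) ℂ} {σ : ι → Matrix B B ℂ}
    (h : ∀ τ, Λ τ = postMeasurement E₀ ρ τ + ∑ j, (E j * (traceSnd ρ ⊗ₖ τ)).trace • σ j) :
    entFidelity Λ = ((Fintype.card B : ℝ) ^ 2)⁻¹ * (score ρ E₀ E σ).re := by
  have h1 : ∑ x, ∑ y, Λ (Matrix.single x y 1) x y = score ρ E₀ E σ := by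
    simp only [h, Matrix.add_apply, Matrix.sum_apply, Matrix.smul_apply, smul_eq_mul,
      Finset.sum_add_distrib, sum_postMeasurement_single, score]
    congr 1
    rw [Finset.sum_congr rfl fun x _ => Finset.sum_comm, Finset.sum_comm]
    exact Finset.sum_congr rfl fun j _ => sum_trace_single_mul _ _ _
  rw [entFidelity_eq, h1, ← Complex.re_ofReal_mul]
  simp

variable [DecidableEq A]

lemma exists_pbt_channel (ρ E₀ : Matrix (A × B) (A × B) ℂ) {ι : Type*} [Fintype ι]
    (E : ι → Matrix (A × B) (A × B) ℂ) (σ : ι → Matrix B B ℂ) :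
    ∃ Λ : Matrix B B ℂ →ₗ[ℂ] Matrix B B ℂ,
      ∀ τ, Λ τ = postMeasurement E₀ ρ τ + ∑ j, (E j * (traceSnd ρ ⊗ₖ τ)).trace • σ j := by
  refine ⟨{ toFun := fun τ => postMeasurement E₀ ρ τ +
      ∑ j, (E j * (traceSnd ρ ⊗ₖ τ)).trace • σ j, map_add' := ?_, map_smul' := ?_ }, fun _ => rfl⟩
  · intro τ τ'
    have : postMeasurement E₀ ρ (τ + τ') = postMeasurement E₀ ρ τ + postMeasurement E₀ ρ τ' := by
      ext b b'
      simp [postMeasurement_apply, mul_add, Finset.sum_add_distrib]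
    simp only [this, kronecker_add, mul_add, trace_add, add_smul, Finset.sum_add_distrib]
    abel
  · intro c τ
    have : postMeasurement E₀ ρ (c • τ) = c • postMeasurement E₀ ρ τ := by
      ext b b'
      simp only [postMeasurement_apply, Matrix.smul_apply, smul_eq_mul, Finset.mul_sum]
      refine Finset.sum_congr rfl fun x _ => Finset.sum_congr rfl fun y _ => ?_
      ring
    simp only [this, kronecker_smul, mul_smul_comm, trace_smul, smul_assoc, smul_add,
      Finset.smul_sum, RingHom.id_apply]

/-- The entanglement fidelities achievable by single-port teleportation are the normalised scores
of POVMs. -/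
lemma mem_image_entFidelity_iff {S : Matrix B B ℂ → Prop} {ρ : Matrix (A × B) (A × B) ℂ} {v : ℝ} :
    v ∈ entFidelity '' pbtChannels S B (singlePort ρ) ↔
      ∃ (m : ℕ) (E : Fin 1 ⊕ Fin m → Matrix (A × B) (A × B) ℂ) (σ : Fin m → Matrix B B ℂ),
        IsPOVM E ∧ (∀ j, S (σ j)) ∧ v = ((Fintype.card B : ℝ) ^ 2)⁻¹ *
          (score ρ (E (Sum.inl 0)) (fun j => E (Sum.inr j)) σ).re := by
  constructor
  · rintro ⟨Λ, ⟨m, E, σ, hE, hσ, hΛ⟩, rfl⟩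
    refine ⟨m, E, σ, hE, hσ, entFidelity_eq_score fun τ => ?_⟩
    simpa [portMarginal_singlePort, traceSnd_singlePort] using hΛ τ
  · rintro ⟨m, E, σ, hE, hσ, rfl⟩
    obtain ⟨Λ, hΛ⟩ := exists_pbt_channel ρ (E (Sum.inl 0)) (fun j => E (Sum.inr j)) σ
    refine ⟨Λ, ⟨m, E, σ, hE, hσ, fun τ => ?_⟩, entFidelity_eq_score hΛ⟩
    simpa [portMarginal_singlePort, traceSnd_singlePort] using hΛ τ

end Fidelity

/-! ### Classical preparations: reduction to basis states and existence of the maximum -/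

section Classical

variable {A : Type*} [Fintype A] {d : ℕ}

lemma isClassicalState_single (x : Fin d) : IsClassicalState (Matrix.single x x (1 : ℂ)) := by
  rw [← diagonal_single]
  refine ⟨⟨PosSemidef.diagonal ?_, ?_⟩, isDiag_diagonal _⟩
  · exact Pi.single_nonneg.2 zero_le_one
  · simp

/-- The normalised score when Bob prepares computational basis states. -/
noncomputable def basisScore (ρ : Matrix (A × Fin d) (A × Fin d) ℂ)
    (G : Fin 1 ⊕ Fin d → Matrix (A × Fin d) (A × Fin d) ℂ) : ℝ :=
  ((d : ℝ) ^ 2)⁻¹ *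
    (score ρ (G (Sum.inl 0)) (fun x => G (Sum.inr x)) fun x => Matrix.single x x 1).re

lemma continuous_basisScore (ρ : Matrix (A × Fin d) (A × Fin d) ℂ) :
    Continuous (basisScore ρ) := by
  unfold basisScore score
  refine continuous_const.mul (Complex.continuous_re.comp ?_)
  refine Continuous.add ?_ (continuous_finsetSum _ fun x _ => ?_)
  · exact ((continuous_apply _).matrix_mul continuous_const).matrix_trace
  · exact ((continuous_apply _).matrix_mul continuous_const).matrix_trace

/-- With classical preparations it suffices to consider one outcome for each computational basis
state. -/
lemma image_entFidelity_PBTcl (ρ : Matrix (Fin d × Fin d) (Fin d × Fin d) ℂ) :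
    entFidelity '' PBTcl (singlePort ρ) = basisScore ρ '' {G | IsPOVM G} := by
  ext v
  rw [PBTcl, mem_image_entFidelity_iff]
  constructor
  · rintro ⟨m, E, σ, hE, hσ, rfl⟩
    have hdiag : ∀ j, σ j = ∑ x, σ j x x • Matrix.single x x (1 : ℂ) := by
      intro j
      conv_lhs => rw [← (hσ j).2.diagonal_diag]
      ext a b
      simp [Matrix.sum_apply, Matrix.single_apply, diagonal_apply, ite_and]
    -- Bob's drawing of `x` with probability `σ j x x` is moved into Alice's measurement.
    refine ⟨Sum.elim (fun _ => E (Sum.inl 0)) fun x => ∑ j, σ j x x • E (Sum.inr j), ⟨?_, ?_⟩, ?_⟩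
    · rintro (i | x)
      · exact hE.1 _
      · exact posSemidef_sum _ fun j _ => (hE.1 _).smul (hσ j).1.1.diag_nonneg
    · have h := hE.2
      simp only [Fintype.sum_sum_type, Sum.elim_inl, Sum.elim_inr, Finset.univ_unique,
        Finset.sum_singleton] at h ⊢
      rw [Finset.sum_comm, ← h]
      congr 1
      refine Finset.sum_congr rfl fun j _ => ?_
      rw [← Finset.sum_smul]
      have : ∑ x, σ j x x = 1 := (hσ j).1.2
      rw [this, one_smul]
    · simp only [basisScore, score, Sum.elim_inl, Sum.elim_inr, Fintype.card_fin]
      refine congrArg (fun z => _ * (_ + z : ℂ).re) ?_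
      simp only [Finset.sum_mul, smul_mul_assoc, trace_sum, trace_smul]
      rw [Finset.sum_comm]
      refine Finset.sum_congr rfl fun j _ => ?_
      have : (traceSnd ρ ⊗ₖ ∑ x, σ j x x • Matrix.single x x (1 : ℂ)) =
          ∑ x, σ j x x • (traceSnd ρ ⊗ₖ Matrix.single x x (1 : ℂ)) := by
        ext a b
        simp only [kroneckerMap_apply, Matrix.sum_apply, Matrix.smul_apply, Finset.mul_sum,
          smul_eq_mul, mul_left_comm]
      conv_rhs => rw [hdiag j, this]
      simp only [Finset.mul_sum, mul_smul_comm, trace_sum, trace_smul]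
  · rintro ⟨G, hG, rfl⟩
    exact ⟨d, G, fun x => Matrix.single x x 1, hG, isClassicalState_single, by
      simp [basisScore]⟩

/-- The number of outcomes is unbounded in the definition; once it is fixed at `d + 1`, the values
are a continuous image of a compact set. -/
lemma isGreatest_Fcl (ρ : Matrix (Fin d × Fin d) (Fin d × Fin d) ℂ) :
    IsGreatest (entFidelity '' PBTcl (singlePort ρ)) (Fcl (singlePort ρ)) := by
  have hc : IsCompact (entFidelity '' PBTcl (singlePort ρ)) := by
    rw [image_entFidelity_PBTcl]
    exact isCompact_setOf_isPOVM.image (continuous_basisScore ρ)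
  refine hc.isGreatest_sSup ?_
  rw [image_entFidelity_PBTcl]
  refine Set.Nonempty.image _ ⟨Sum.elim (fun _ => 1) fun _ => 0, ?_, ?_⟩
  · rintro (_ | _)
    · exact PosSemidef.one
    · exact PosSemidef.zero
  · simp

end Classical

/-! ### Upper bounds for the isotropic state -/

section Isotropic

variable {d : ℕ}

lemma traceSnd_isotropic (hd : 2 ≤ d) (f : ℝ) :
    traceSnd (isotropic d f) = (d : ℂ)⁻¹ • 1 := by
  have hd' : (2 : ℝ) ≤ d := by exact_mod_cast hd
  have h1 : (d : ℂ) ≠ 0 := by exact_mod_cast (by positivity : (d : ℝ) ≠ 0)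
  have h2 : (d : ℂ) ^ 2 - 1 ≠ 0 := by exact_mod_cast (by nlinarith : (d : ℝ) ^ 2 - 1 ≠ 0)
  have hΦ : traceSnd (maxEntState (Fin d)) = (d : ℂ)⁻¹ • 1 := by
    ext x y
    simp [traceSnd, maxEntState_apply, one_apply, ite_and, eq_comm]
  have hone : traceSnd (1 : Matrix (Fin d × Fin d) (Fin d × Fin d) ℂ) = (d : ℂ) • 1 := by
    ext x y
    simp [traceSnd, one_apply]
  have hlin : traceSnd (isotropic d f) = (f : ℂ) • traceSnd (maxEntState (Fin d)) +
      (((1 - f) / ((d : ℝ) ^ 2 - 1) : ℝ) : ℂ) • (traceSnd (1 : Matrix (Fin d × Fin d) (Fin d × Fin d) ℂ) -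
        traceSnd (maxEntState (Fin d))) := by
    ext x y
    simp [traceSnd, isotropic, Finset.sum_add_distrib, ← Finset.mul_sum]
  rw [hlin, hΦ, hone, ← sub_smul, smul_smul, smul_smul, ← add_smul]
  congr 1
  push_cast
  field_simp
  ring

/-- Completeness, `Tr E₀ + ∑ⱼ Tr Eⱼ = d²`, trades the preparation terms for the constant `d` and
deficits. -/
lemma score_isotropic (hd : 2 ≤ d) (f : ℝ) {m : ℕ}
    {E : Fin 1 ⊕ Fin m → Matrix (Fin d × Fin d) (Fin d × Fin d) ℂ} (hE : IsPOVM E)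
    (σ : Fin m → Matrix (Fin d) (Fin d) ℂ) :
    (score (isotropic d f) (E (Sum.inl 0)) (fun j => E (Sum.inr j)) σ).re =
      d + (f - 1 / d) * (E (Sum.inl 0) * maxEntState (Fin d)).trace.re
      - (1 / d - (1 - f) / ((d : ℝ) ^ 2 - 1)) *
        ((E (Sum.inl 0)).trace.re - (E (Sum.inl 0) * maxEntState (Fin d)).trace.re)
      - 1 / d * ∑ j, ((E (Sum.inr j)).trace.re -
        (E (Sum.inr j) * ((1 : Matrix (Fin d) (Fin d) ℂ) ⊗ₖ σ j)).trace.re) := by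
  have hd0 : (d : ℝ) ≠ 0 := by positivity
  have htr : (E (Sum.inl 0)).trace.re + ∑ j, (E (Sum.inr j)).trace.re = (d : ℝ) ^ 2 := by
    have h := congrArg (fun M => (trace M).re) hE.2
    simpa [Fintype.sum_sum_type, trace_sum, sq] using h
  have hσ : ∀ j, (E (Sum.inr j) * (traceSnd (isotropic d f) ⊗ₖ σ j)).trace.re =
      (d : ℝ)⁻¹ * (E (Sum.inr j) * ((1 : Matrix (Fin d) (Fin d) ℂ) ⊗ₖ σ j)).trace.re := by
    intro j
    rw [traceSnd_isotropic hd, smul_kronecker, mul_smul_comm, trace_smul, smul_eq_mul,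
      ← Complex.re_ofReal_mul]
    simp
  have h0 : (E (Sum.inl 0) * isotropic d f).trace.re =
      f * (E (Sum.inl 0) * maxEntState (Fin d)).trace.re + (1 - f) / ((d : ℝ) ^ 2 - 1) *
        ((E (Sum.inl 0)).trace.re - (E (Sum.inl 0) * maxEntState (Fin d)).trace.re) := by
    rw [isotropic, mul_add, mul_smul_comm, mul_smul_comm, mul_sub, mul_one, trace_add, trace_smul,
      trace_smul, trace_sub, Complex.add_re, smul_eq_mul, smul_eq_mul, Complex.re_ofReal_mul,
      Complex.re_ofReal_mul, Complex.sub_re]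
  rw [score, Complex.add_re, Complex.re_sum, h0, Finset.sum_congr rfl fun j _ => hσ j,
    ← Finset.mul_sum, Finset.sum_sub_distrib, eq_sub_of_add_eq' htr]
  field_simp
  ring

/-- Holds since `d < d² - 1` for `d ≥ 2`. Strictness matters in the equality case, where it forces
`Tr E₀ = Tr (E₀ Φ⁺)`. -/
lemma isotropic_coeff_lt (hd : 2 ≤ d) {f : ℝ} (hf : 0 ≤ f) :
    (1 - f) / ((d : ℝ) ^ 2 - 1) < 1 / d := by
  have hd' : (2 : ℝ) ≤ d := by exact_mod_cast hd
  rw [div_lt_div_iff₀ (by nlinarith) (by positivity)]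
  nlinarith

variable {X ι : Type*} [Fintype X] [DecidableEq X] [Fintype ι]

lemma trace_mul_maxEntState_re_nonneg {M : Matrix (X × X) (X × X) ℂ} (hM : M.PosSemidef) :
    0 ≤ (M * maxEntState X).trace.re := by
  rw [maxEntState, trace_mul_vecMulVec_star]
  exact (Complex.le_def.1 (hM.dotProduct_mulVec_nonneg _)).1

lemma trace_mul_maxEntState_re_le [Nonempty X] {M : Matrix (X × X) (X × X) ℂ}
    (hM : M.PosSemidef) : (M * maxEntState X).trace.re ≤ M.trace.re := by
  simpa [trace_maxEntState] using trace_mul_re_le hM (maxEntState_posSemidef (B := X))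

lemma IsPOVM.trace_mul_maxEntState_re_le_one [Nonempty X]
    {E : ι → Matrix (X × X) (X × X) ℂ} (hE : IsPOVM E) (i : ι) :
    (E i * maxEntState X).trace.re ≤ 1 := by
  have h := congrArg (fun M => (M * maxEntState X).trace.re) hE.2
  simp only [Finset.sum_mul, trace_sum, Complex.re_sum, one_mul, trace_maxEntState,
    Complex.one_re] at h
  rw [← h]
  exact Finset.single_le_sum (f := fun i => (E i * maxEntState X).trace.re)
    (fun j _ => trace_mul_maxEntState_re_nonneg (hE.1 j)) (Finset.mem_univ i)

lemma score_isotropic_le (hd : 2 ≤ d) {f : ℝ} (hf : 0 ≤ f) {m : ℕ}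
    {E : Fin 1 ⊕ Fin m → Matrix (Fin d × Fin d) (Fin d × Fin d) ℂ} (hE : IsPOVM E)
    {σ : Fin m → Matrix (Fin d) (Fin d) ℂ} (hσ : ∀ j, IsState (σ j)) :
    (score (isotropic d f) (E (Sum.inl 0)) (fun j => E (Sum.inr j)) σ).re ≤
      d + max (f - 1 / d) 0 := by
  have : NeZero d := ⟨by omega⟩
  rw [score_isotropic hd f hE]
  have hp0 := trace_mul_maxEntState_re_nonneg (hE.1 (Sum.inl 0))
  have hp1 := hE.trace_mul_maxEntState_re_le_one (Sum.inl 0)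
  have h1 := mul_nonneg (sub_nonneg.2 (isotropic_coeff_lt hd hf).le)
    (sub_nonneg.2 (trace_mul_maxEntState_re_le (hE.1 (Sum.inl 0))))
  have h2 : 0 ≤ 1 / (d : ℝ) * ∑ j, ((E (Sum.inr j)).trace.re -
        (E (Sum.inr j) * ((1 : Matrix (Fin d) (Fin d) ℂ) ⊗ₖ σ j)).trace.re) :=
    mul_nonneg (by positivity) (Finset.sum_nonneg fun j _ =>
      sub_nonneg.2 (trace_mul_one_kronecker_re_le (hE.1 _) (hσ j)))
  have h3 : (f - 1 / d) * (E (Sum.inl 0) * maxEntState (Fin d)).trace.re ≤ max (f - 1 / d) 0 :=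
    (mul_le_mul_of_nonneg_right (le_max_left _ _) hp0).trans
      (mul_le_of_le_one_right (le_max_right _ _) hp1)
  linarith

/-- Preparing basis states never reaches the optimum above the threshold `f = 1 / d`. -/
lemma basisScore_isotropic_lt (hd : 2 ≤ d) {f : ℝ} (hf : 1 / d < f)
    {G : Fin 1 ⊕ Fin d → Matrix (Fin d × Fin d) (Fin d × Fin d) ℂ} (hG : IsPOVM G) :
    basisScore (isotropic d f) G < ((d : ℝ) ^ 2)⁻¹ * (d + (f - 1 / d)) := by
  have : NeZero d := ⟨by omega⟩
  have hd' : (2 : ℝ) ≤ d := by exact_mod_cast hd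
  have hf0 : 0 ≤ f := le_trans (by positivity) hf.le
  refine mul_lt_mul_of_pos_left ?_ (by positivity)
  rw [score_isotropic hd f hG]
  have hp1 := hG.trace_mul_maxEntState_re_le_one (Sum.inl 0)
  have hpt := trace_mul_maxEntState_re_le (hG.1 (Sum.inl 0))
  have hβ := isotropic_coeff_lt hd hf0
  have h1 := mul_nonneg (sub_nonneg.2 hβ.le) (sub_nonneg.2 hpt)
  have hs : ∀ x : Fin d, 0 ≤ (G (Sum.inr x)).trace.re - (G (Sum.inr x) *
      ((1 : Matrix (Fin d) (Fin d) ℂ) ⊗ₖ Matrix.single x x 1)).trace.re := fun x =>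
    sub_nonneg.2 (trace_mul_one_kronecker_re_le (hG.1 _) (isClassicalState_single x).1)
  have h2 := mul_nonneg (by positivity : 0 ≤ 1 / (d : ℝ))
    (Finset.sum_nonneg fun x (_ : x ∈ Finset.univ) => hs x)
  have h3 : 0 ≤ (f - 1 / d) * (1 - (G (Sum.inl 0) * maxEntState (Fin d)).trace.re) :=
    mul_nonneg (sub_nonneg.2 hf.le) (sub_nonneg.2 hp1)
  by_contra! hle
  -- Under `hle` the three nonnegative deficits have sum at most zero, so each vanishes: `Tr E₀ =
  -- p`, no preparation deficit, and `p = 1`.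
  have e1 := (mul_eq_zero.1 (le_antisymm (by linarith) h1)).resolve_left (sub_pos.2 hβ).ne'
  have e2 := (mul_eq_zero.1 (le_antisymm (by linarith) h2)).resolve_left (by positivity)
  have e3 := (mul_eq_zero.1 (le_antisymm (by linarith) h3)).resolve_left (sub_pos.2 hf).ne'
  rw [Finset.sum_eq_zero_iff_of_nonneg fun x _ => hs x] at e2
  have hdiag : ∀ x a b : Fin d, b ≠ x → (G (Sum.inr x) (a, b) (a, b)).re = 0 := by
    intro x a b hb
    have h := e2 x (Finset.mem_univ x)
    have key : (G (Sum.inr x)).trace.re - (G (Sum.inr x) *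
        ((1 : Matrix (Fin d) (Fin d) ℂ) ⊗ₖ Matrix.single x x 1)).trace.re =
        ∑ a, ∑ b, if b = x then 0 else (G (Sum.inr x) (a, b) (a, b)).re := by
      rw [trace_mul_one_kronecker, trace_mul_single]
      simp only [trace, diag_apply, Fintype.sum_prod_type, Complex.re_sum, traceFst, of_apply,
        MulOpposite.op_one, one_smul]
      rw [← Finset.sum_sub_distrib]
      refine Finset.sum_congr rfl fun a _ => ?_
      have hx : (G (Sum.inr x) (a, x) (a, x)).re =
          ∑ b, if b = x then (G (Sum.inr x) (a, b) (a, b)).re else 0 := by simp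
      rw [hx, ← Finset.sum_sub_distrib]
      exact Finset.sum_congr rfl fun b _ => by split_ifs <;> simp
    have hn : ∀ a b, 0 ≤ if b = x then 0 else (G (Sum.inr x) (a, b) (a, b)).re := by
      intro a b
      split_ifs
      · exact le_rfl
      · exact posSemidef_diag_re_nonneg (hG.1 _) _
    rw [key, Finset.sum_eq_zero_iff_of_nonneg fun a _ => Finset.sum_nonneg fun b _ => hn a b] at h
    have h := h a (Finset.mem_univ a)
    rw [Finset.sum_eq_zero_iff_of_nonneg fun b _ => hn a b] at h
    simpa [hb] using h b (Finset.mem_univ b)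
  -- No `x` equals both `y` and `z`, so each preparation element has a zero diagonal entry at `(y,
  -- y)` or `(z, z)`, which kills the entry joining them. `E₀` then inherits the zero of the
  -- identity.
  have hoff : ∀ y z : Fin d, y ≠ z → G (Sum.inl 0) (y, y) (z, z) = 0 := by
    intro y z hyz
    have h := congrArg (fun M : Matrix (Fin d × Fin d) (Fin d × Fin d) ℂ => M (y, y) (z, z)) hG.2
    simp only [Fintype.sum_sum_type, Finset.univ_unique, Finset.sum_singleton,
      Matrix.sum_apply] at h
    rw [Finset.sum_eq_zero fun x _ => ?_, add_zero, one_apply_ne (by simp [hyz])] at h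
    · exact h
    · by_cases hy : y = x
      · exact posSemidef_apply_eq_zero_right (hG.1 _) (hdiag x z z fun hz => hyz (hy.trans hz.symm)) _
      · exact posSemidef_apply_eq_zero_left (hG.1 _) (hdiag x y y hy) _
  have hp : (G (Sum.inl 0) * maxEntState (Fin d)).trace.re =
      (d : ℝ)⁻¹ * ∑ y, (G (Sum.inl 0) (y, y) (y, y)).re := by
    rw [trace_mul_maxEntState, Finset.sum_congr rfl fun y _ =>
      Finset.sum_eq_single y (fun z _ hz => hoff y z hz.symm) (by simp), Fintype.card_fin,
      ← Complex.re_sum, ← Complex.re_ofReal_mul]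
    simp
  have hle' : ∑ y, (G (Sum.inl 0) (y, y) (y, y)).re ≤ (G (Sum.inl 0)).trace.re := by
    simp only [trace, diag_apply, Fintype.sum_prod_type, Complex.re_sum]
    exact Finset.sum_le_sum fun y _ => Finset.single_le_sum
      (f := fun z => (G (Sum.inl 0) (y, z) (y, z)).re)
      (fun z _ => posSemidef_diag_re_nonneg (hG.1 _) _) (Finset.mem_univ y)
  -- Without coherences `p ≤ Tr E₀ / d`, while `p = Tr E₀ = 1`.
  have h4 : (1 : ℝ) ≤ (d : ℝ)⁻¹ := by
    have h5 := mul_le_mul_of_nonneg_left hle' (by positivity : 0 ≤ (d : ℝ)⁻¹)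
    have h6 : (G (Sum.inl 0)).trace.re = 1 := by linarith
    rw [← hp, h6] at h5
    linarith
  have h7 : (d : ℝ)⁻¹ < 1 := inv_lt_one_of_one_lt₀ (by linarith)
  linarith

end Isotropic

/-! ### A separable decomposition of `1 - Φ⁺` -/

section Separable

lemma vecMulVec_mul_self {B : Type*} [Fintype B] (v : B → ℂ) :
    vecMulVec v (star v) * vecMulVec v (star v) = (star v ⬝ᵥ v) • vecMulVec v (star v) := by
  rw [vecMulVec_mul_vecMulVec, vecMulVec_smul]

variable {A B : Type*} [Fintype A] [DecidableEq A] [Fintype B] [DecidableEq B]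

/-- Positive operators `M` on `A ⊗ B` such that `M (1 ⊗ σ) = M` for some state `σ`: when Alice
obtains `M`, preparing `σ` is optimal. -/
def guessable (A B : Type*) [Fintype A] [DecidableEq A] [Fintype B] [DecidableEq B] :
    Set (Matrix (A × B) (A × B) ℂ) :=
  {M | M.PosSemidef ∧ ∃ σ, IsState σ ∧ M * ((1 : Matrix A A ℂ) ⊗ₖ σ) = M}

lemma smul_kronecker_vecMulVec_mem_guessable {c : ℂ} (hc : 0 ≤ c) {M : Matrix A A ℂ}
    (hM : M.PosSemidef) {v : B → ℂ} (hv : v ≠ 0) :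
    c • (M ⊗ₖ vecMulVec v (star v)) ∈ guessable A B := by
  have hv0 : star v ⬝ᵥ v ≠ 0 := by simpa [dotProduct_comm] using hv
  have hv1 : 0 ≤ star v ⬝ᵥ v := dotProduct_star_self_nonneg v
  refine ⟨(hM.kronecker (posSemidef_vecMulVec_self_star v)).smul hc,
    (star v ⬝ᵥ v)⁻¹ • vecMulVec v (star v),
    ⟨(posSemidef_vecMulVec_self_star v).smul ?_, ?_⟩, ?_⟩
  · exact inv_nonneg.2 hv1
  · rw [trace_smul, trace_vecMulVec, dotProduct_comm v, smul_eq_mul, inv_mul_cancel₀ hv0]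
  · rw [smul_mul_assoc, ← mul_kronecker_mul, mul_one, mul_smul_comm, vecMulVec_mul_self,
      smul_smul, inv_mul_cancel₀ hv0, one_smul]

/-- The operator `(|ii⟩ - |jj⟩)(⟨ii| - ⟨jj|) + |ij⟩⟨ij| + |ji⟩⟨ji|`. -/
def pairOp (i j : B) : Matrix (B × B) (B × B) ℂ :=
  vecMulVec (Pi.single (i, i) 1 - Pi.single (j, j) 1) (Pi.single (i, i) 1 - Pi.single (j, j) 1) +
    Matrix.single (i, j) (i, j) 1 + Matrix.single (j, i) (j, i) 1

/-- `pairOp i j` is separable: it is an average over the fourth roots of unity `ω` of the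
projections onto `(|i⟩ + ω |j⟩) ⊗ (|i⟩ - ω̄ |j⟩)`. -/
lemma pairOp_eq (i j : B) :
    pairOp i j = ∑ k : Fin 4, (4 : ℂ)⁻¹ •
      (vecMulVec (Pi.single i 1 + Complex.I ^ (k : ℕ) • Pi.single j 1)
          (star (Pi.single i 1 + Complex.I ^ (k : ℕ) • Pi.single j 1)) ⊗ₖ
        vecMulVec (Pi.single i 1 - star (Complex.I ^ (k : ℕ)) • Pi.single j 1)
          (star (Pi.single i 1 - star (Complex.I ^ (k : ℕ)) • Pi.single j 1))) := by
  have h3 : Complex.I ^ 3 = -Complex.I := by rw [pow_succ, Complex.I_sq]; ring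
  have hs : ∀ i : B, star (Pi.single i (1 : ℂ)) = (Pi.single i 1 : B → ℂ) := fun i => by
    rw [← Pi.single_star, star_one]
  -- The product vector is `|ii⟩ - |jj⟩ + ω |ji⟩ - ω̄ |ij⟩`. Averaging kills the cross terms, which
  -- carry `ω^{±1}` or `ω^{±2}`; the latter would survive with `ω = ±1` only.
  ext ⟨a, b⟩ ⟨a', b'⟩
  have hprod : ∀ i j : B, ∀ p : B × B, (Pi.single (i, j) (1 : ℂ) : B × B → ℂ) p =
      (Pi.single i 1 : B → ℂ) p.1 * (Pi.single j 1 : B → ℂ) p.2 := by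
    intro i j p
    simp only [Pi.single_apply, Prod.ext_iff, ite_and]
    split_ifs <;> simp
  have hsing : ∀ i j : B, ∀ p q : B × B, Matrix.single (i, j) (i, j) (1 : ℂ) p q =
      (Pi.single (i, j) (1 : ℂ) : B × B → ℂ) p * (Pi.single (i, j) (1 : ℂ) : B × B → ℂ) q := by
    intro i j p q
    simp only [Matrix.single_apply, Pi.single_apply, ite_and, eq_comm (a := (i, j))]
    split_ifs <;> simp
  simp only [pairOp, Matrix.add_apply, vecMulVec_apply, hsing, Pi.sub_apply, hprod,
    Matrix.sum_apply, Fin.sum_univ_four, Matrix.smul_apply, kroneckerMap_apply, Pi.add_apply,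
    Pi.smul_apply, star_add, star_sub, star_smul, hs, smul_eq_mul, star_star]
  simp only [Fin.val_zero, Fin.val_one, Fin.val_two, pow_zero, pow_one, Complex.I_sq,
    show ((3 : Fin 4) : ℕ) = 3 from rfl, h3, star_one, star_neg, Complex.star_def, Complex.conj_I]
  have h4 : Complex.I ^ 4 = 1 := Complex.I_pow_four
  ring_nf
  simp only [Complex.I_sq, h4]
  ring

lemma single_mem_guessable (i : A) (j : B) :
    Matrix.single (i, j) (i, j) (1 : ℂ) ∈ guessable A B := by
  have h := smul_kronecker_vecMulVec_mem_guessable zero_le_one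
    (posSemidef_vecMulVec_self_star (Pi.single i (1 : ℂ)))
    (v := Pi.single j (1 : ℂ)) (by simp)
  have hs : Matrix.single (i, j) (i, j) (1 : ℂ) = (1 : ℂ) •
      (vecMulVec (Pi.single i (1 : ℂ)) (star (Pi.single i 1)) ⊗ₖ
        vecMulVec (Pi.single j (1 : ℂ)) (star (Pi.single j 1))) := by
    ext ⟨a, b⟩ ⟨a', b'⟩
    rw [one_smul, kroneckerMap_apply, ← Pi.single_star, ← Pi.single_star, star_one]
    simp only [vecMulVec_apply, Pi.single_apply, Matrix.single_apply, Prod.ext_iff, ite_and,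
      eq_comm (a := i), eq_comm (a := j)]
    split_ifs <;> simp
  rwa [hs]

lemma smul_mem_closure_guessable {c : ℂ} (hc : 0 ≤ c) {M : Matrix (A × B) (A × B) ℂ}
    (hM : M ∈ AddSubmonoid.closure (guessable A B)) :
    c • M ∈ AddSubmonoid.closure (guessable A B) := by
  induction hM using AddSubmonoid.closure_induction with
  | mem M hM =>
    obtain ⟨h, σ, hσ, e⟩ := hM
    exact AddSubmonoid.subset_closure ⟨h.smul hc, σ, hσ, by rw [smul_mul_assoc, e]⟩
  | zero => rw [smul_zero]; exact zero_mem _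
  | add M N _ _ hM hN => rw [smul_add]; exact add_mem hM hN

lemma sum_single_self_one {X : Type*} [Fintype X] [DecidableEq X] :
    ∑ p : X, Matrix.single p p (1 : ℂ) = 1 := by
  ext p q
  simp [Matrix.sum_apply, Matrix.single_apply, one_apply, ite_and]

lemma one_mem_closure_guessable :
    (1 : Matrix (A × B) (A × B) ℂ) ∈ AddSubmonoid.closure (guessable A B) := by
  rw [← sum_single_self_one]
  exact sum_mem fun p _ => AddSubmonoid.subset_closure (single_mem_guessable p.1 p.2)

lemma pairOp_mem_closure_guessable {i j : B} (hij : i ≠ j) :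
    pairOp i j ∈ AddSubmonoid.closure (guessable B B) := by
  rw [pairOp_eq]
  refine sum_mem fun k _ => AddSubmonoid.subset_closure
    (smul_kronecker_vecMulVec_mem_guessable (by positivity) (posSemidef_vecMulVec_self_star _) ?_)
  intro h
  have h := congrFun h i
  simp [hij] at h

/-- The terms `i = j` are included to keep the sums free; they are removed later by
`sum_offDiag_eq_sub`. -/
lemma sum_pairOp :
    ∑ p : B × B, pairOp p.1 p.2 = (2 * Fintype.card B : ℂ) •
      (∑ i : B, Matrix.single (i, i) (i, i) 1 - maxEntState B) + (2 : ℂ) • 1 := by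
  have h1 : ∑ i : B, ∑ j : B, Matrix.single (i, j) (i, j) (1 : ℂ) = 1 := by
    rw [← sum_single_self_one, Fintype.sum_prod_type]
  have h2 : ∑ i : B, ∑ j : B, Matrix.single (j, i) (j, i) (1 : ℂ) = 1 := by
    rw [Finset.sum_comm, h1]
  have h3 : ∑ i : B, ∑ j : B, Matrix.single (i, i) (j, j) (1 : ℂ) =
      (Fintype.card B : ℂ) • maxEntState B := by
    ext ⟨a, b⟩ ⟨a', b'⟩
    have : Nonempty B := ⟨a⟩
    simp [Matrix.sum_apply, Matrix.single_apply, maxEntState_apply, ite_and,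
      Finset.sum_ite_irrel]
  have h4 : ∑ i : B, ∑ j : B, Matrix.single (j, j) (i, i) (1 : ℂ) =
      (Fintype.card B : ℂ) • maxEntState B := by
    rw [Finset.sum_comm, h3]
  have h5 : ∀ p q : B × B, vecMulVec (Pi.single p (1 : ℂ)) (Pi.single q 1) =
      Matrix.single p q 1 := fun p q => (single_eq_single_vecMulVec_single p q).symm
  simp only [pairOp, Fintype.sum_prod_type, sub_vecMulVec, vecMulVec_sub, h5,
    Finset.sum_add_distrib, Finset.sum_sub_distrib, h1, h2, h3, h4, Finset.sum_const,
    Finset.card_univ, ← Finset.smul_sum]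
  module

lemma sum_offDiag_eq_sub {M : Type*} [AddCommGroup M] (g : B × B → M) :
    ∑ p ∈ (Finset.univ : Finset B).offDiag, g p = ∑ p, g p - ∑ i, g (i, i) := by
  rw [eq_sub_iff_add_eq', ← Finset.sum_diag, ← Finset.sum_union (Finset.disjoint_diag_offDiag _),
    Finset.diag_union_offDiag, Finset.univ_product_univ]

/-- A separable decomposition of the complement of the maximally entangled state. -/
lemma one_sub_maxEntState_eq [Nonempty B] :
    1 - maxEntState B =
      (2 * Fintype.card B : ℂ)⁻¹ • ∑ p ∈ (Finset.univ : Finset B).offDiag, pairOp p.1 p.2 +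
        ((1 - (Fintype.card B : ℝ)⁻¹ : ℝ) : ℂ) •
          ∑ p ∈ (Finset.univ : Finset B).offDiag, Matrix.single p p 1 := by
  have h : (Fintype.card B : ℂ) ≠ 0 := by simp
  have hdiag : ∀ i : B, pairOp i i = (2 : ℂ) • Matrix.single (i, i) (i, i) 1 := by
    intro i
    rw [pairOp, sub_self, zero_vecMulVec, zero_add, two_smul]
  -- Divided by `2d`, the `pairOp` sum has the right `Φ⁺` part but weight only `1/d` on each
  -- `|ij⟩⟨ij|`, `i ≠ j`; the second sum supplies the missing `1 - 1/d`.
  rw [sum_offDiag_eq_sub, sum_offDiag_eq_sub, sum_pairOp, sum_single_self_one,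
    Finset.sum_congr rfl fun i _ => hdiag i, ← Finset.smul_sum]
  ext p q
  simp only [Matrix.add_apply, Matrix.sub_apply, Matrix.smul_apply, smul_eq_mul]
  push_cast
  field_simp
  ring

lemma one_sub_maxEntState_mem_closure_guessable [Nonempty B] :
    1 - maxEntState B ∈ AddSubmonoid.closure (guessable B B) := by
  rw [one_sub_maxEntState_eq]
  refine add_mem (smul_mem_closure_guessable ?_ (sum_mem fun p hp => ?_))
    (smul_mem_closure_guessable ?_ (sum_mem fun p hp => ?_))
  · positivity
  · exact pairOp_mem_closure_guessable (Finset.mem_offDiag.1 hp).2.2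
  · rw [Complex.zero_le_real, sub_nonneg]
    exact inv_le_one_of_one_le₀ (by exact_mod_cast Fintype.card_pos)
  · exact AddSubmonoid.subset_closure (single_mem_guessable p.1 p.2)

/-- Membership in the closure gives a finite list of guessable summands; each becomes an outcome
with its own state. -/
lemma exists_povm_of_one_sub_mem_closure_guessable {E₀ : Matrix (A × B) (A × B) ℂ}
    (h₀ : E₀.PosSemidef) (h : 1 - E₀ ∈ AddSubmonoid.closure (guessable A B)) :
    ∃ (m : ℕ) (E : Fin 1 ⊕ Fin m → Matrix (A × B) (A × B) ℂ) (σ : Fin m → Matrix B B ℂ),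
      IsPOVM E ∧ (∀ j, IsState (σ j)) ∧ E (Sum.inl 0) = E₀ ∧
      ∀ j, E (Sum.inr j) * ((1 : Matrix A A ℂ) ⊗ₖ σ j) = E (Sum.inr j) := by
  obtain ⟨l, hl, hsum⟩ := AddSubmonoid.exists_list_of_mem_closure h
  choose hpos σ hσ hEσ using fun j : Fin l.length => hl (l.get j) (l.get_mem j)
  refine ⟨l.length, Sum.elim (fun _ => E₀) l.get, σ, ⟨?_, ?_⟩, hσ, rfl, hEσ⟩
  · rintro (_ | j)
    · exact h₀
    · exact hpos j
  · have : ∑ j, l.get j = 1 - E₀ := by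
      rw [← hsum]
      exact Fin.sum_univ_getElem l
    simp only [Fintype.sum_sum_type, Sum.elim_inl, Sum.elim_inr, Finset.univ_unique,
      Finset.sum_singleton, this, add_sub_cancel]

end Separable

/-! ### Optimal quantum protocols -/

section Optimum

variable {d : ℕ}

/-- `ht` cancels the first deficit, and the states of the guessable summands cancel the second. -/
lemma exists_fidelity_eq (hd : 2 ≤ d) (f : ℝ) {E₀ : Matrix (Fin d × Fin d) (Fin d × Fin d) ℂ}
    (h₀ : E₀.PosSemidef) (h : 1 - E₀ ∈ AddSubmonoid.closure (guessable (Fin d) (Fin d)))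
    (ht : E₀.trace.re = (E₀ * maxEntState (Fin d)).trace.re) :
    ((d : ℝ) ^ 2)⁻¹ * (d + (f - 1 / d) * (E₀ * maxEntState (Fin d)).trace.re) ∈
      entFidelity '' PBTq (singlePort (isotropic d f)) := by
  obtain ⟨m, E, σ, hE, hσ, rfl, hEσ⟩ := exists_povm_of_one_sub_mem_closure_guessable h₀ h
  rw [PBTq, mem_image_entFidelity_iff]
  refine ⟨m, E, σ, hE, hσ, ?_⟩
  rw [score_isotropic hd f hE]
  simp [ht, hEσ]

lemma isGreatest_image_entFidelity_PBTq (hd : 2 ≤ d) {f : ℝ} (hf : 0 ≤ f) :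
    IsGreatest (entFidelity '' PBTq (singlePort (isotropic d f)))
      (((d : ℝ) ^ 2)⁻¹ * (d + max (f - 1 / d) 0)) := by
  have : NeZero d := ⟨by omega⟩
  constructor
  · rcases le_total (f - 1 / d) 0 with h | h
    · rw [max_eq_right h]
      -- Below the threshold the port is never used: `E₀ = 0`.
      simpa using exists_fidelity_eq hd f PosSemidef.zero
        (by rw [sub_zero]; exact one_mem_closure_guessable) (by simp)
    · rw [max_eq_left h]
      have hΦ : (maxEntState (Fin d) * maxEntState (Fin d)).trace = 1 := by
        have hd0 : (d : ℂ) ≠ 0 := by exact_mod_cast (NeZero.ne d)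
        rw [trace_mul_maxEntState]
        simp [maxEntState_apply, hd0]
      -- Above it, the port is kept exactly on the outcome `Φ⁺`.
      simpa [hΦ] using exists_fidelity_eq hd f maxEntState_posSemidef
        one_sub_maxEntState_mem_closure_guessable (by rw [hΦ, trace_maxEntState])
  · rintro v hv
    rw [PBTq, mem_image_entFidelity_iff] at hv
    obtain ⟨m, E, σ, hE, hσ, rfl⟩ := hv
    rw [Fintype.card_fin]
    exact mul_le_mul_of_nonneg_left (score_isotropic_le hd hf hE hσ) (by positivity)

end Optimum

end AsyncPBT

theorem mainTheorem3 (d : ℕ) (hd : 2 ≤ d) (f : ℝ) (hf0 : 0 ≤ f) (hf1 : f ≤ 1) :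
    -- both optimal fidelities are maxima, attained over the respective class of channels
    IsGreatest (AsyncPBT.entFidelity '' AsyncPBT.PBTq (AsyncPBT.singlePort (AsyncPBT.isotropic d f)))
      (AsyncPBT.Fq (AsyncPBT.singlePort (AsyncPBT.isotropic d f))) ∧
    IsGreatest (AsyncPBT.entFidelity '' AsyncPBT.PBTcl (AsyncPBT.singlePort (AsyncPBT.isotropic d f)))
      (AsyncPBT.Fcl (AsyncPBT.singlePort (AsyncPBT.isotropic d f))) ∧
    -- the value under arbitrary state preparation
    AsyncPBT.Fq (AsyncPBT.singlePort (AsyncPBT.isotropic d f)) =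
      (if 1 / (d : ℝ) ≤ f then 1 / (d : ℝ) + f / (d : ℝ) ^ 2 - 1 / (d : ℝ) ^ 3
        else 1 / (d : ℝ)) ∧
    -- strict separation from classical state preparation
    (1 / (d : ℝ) < f →
      AsyncPBT.Fcl (AsyncPBT.singlePort (AsyncPBT.isotropic d f)) <
        AsyncPBT.Fq (AsyncPBT.singlePort (AsyncPBT.isotropic d f))) := by
  have hd0 : (d : ℝ) ≠ 0 := by positivity
  have hq := AsyncPBT.isGreatest_image_entFidelity_PBTq hd hf0
  have hc := AsyncPBT.isGreatest_Fcl (AsyncPBT.isotropic d f)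
  have hFq : AsyncPBT.Fq (AsyncPBT.singlePort (AsyncPBT.isotropic d f)) = _ := hq.csSup_eq
  refine ⟨hFq ▸ hq, hc, ?_, fun hf => ?_⟩
  · rw [hFq]
    split_ifs with h
    · rw [max_eq_left (sub_nonneg.2 h)]
      field_simp
      ring
    · rw [max_eq_right (sub_nonpos.2 (not_le.1 h).le)]
      field_simp
      ring
  -- Since the classical maximum is attained, strictness for each POVM passes to the supremum.
  · obtain ⟨G, hG, hGv⟩ := AsyncPBT.image_entFidelity_PBTcl (AsyncPBT.isotropic d f) ▸ hc.1
    rw [hFq, max_eq_left (sub_nonneg.2 hf.le), ← hGv]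
    exact AsyncPBT.basisScore_isotropic_lt hd hf hG
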